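/- Let $M\subseteq B(H)$ be a von Neumann algebra with a normal faithful tracial state $\tau$. Let $M^{\mathrm{op}}$ be the opposite von Neumann algebra: the set $M$ with the same linear structure and $*$-operation and with the multiplication $a\cdot b=ba$, represented on the dual (conjugate) Hilbert space $H^*$ by letting $b\in M$ act as its transpose $\varphi\mapsto\varphi\circ b$. Let $M\,\overline{\otimes}\,M^{\mathrm{op}}$ be the von Neumann algebra tensor product, i.e. the von Neumann algebra on the Hilbert space tensor product $H\otimes H^*$ generated by the operators $a\otimes b$ with $a\in M$, $b\in M^{\mathrm{op}}$. Then $M\,\overline{\otimes}\,M^{\mathrm{op}}$ has an involutory $*$-antiautomorphism, that is, a complex linear map $\alpha:M\,\overline{\otimes}\,M^{\mathrm{op}}\to M\,\overline{\otimes}\,M^{\mathrm{op}}$ with $\alpha(x^*)=\alpha(x)^*$, $\alpha(xy)=\alpha(y)\alpha(x)$ and $\alpha(\alpha(x))=x$ for all $x,y$. Moreover, $\alpha$ can be chosen such that $\alpha(a\otimes b)=b\otimes a$ for all $a,b\in M$ (the sets $M$ and $M^{\mathrm{op}}$ being identified). -/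

import Mathlib

open scoped TensorProduct ComplexOrder InnerProductSpace

noncomputable section

universe u v

/-! ### The dual of a Hilbert space as a Hilbert space -/

section DualHilbert

variable {H : Type u} [NormedAddCommGroup H] [InnerProductSpace ℂ H] [CompleteSpace H]

/-- The Hilbert space structure on the dual of a Hilbert space `H`, with the operator norm as norm
and `⟪φ, ψ⟫ = ⟪y, x⟫` if `φ = ⟪x, ·⟫` and `ψ = ⟪y, ·⟫`. Up to the Riesz isomorphism it is the
conjugate Hilbert space of `H`. -/
instance instInnerProductSpaceStrongDual : InnerProductSpace ℂ (StrongDual ℂ H) where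
  inner φ ψ := ⟪(InnerProductSpace.toDual ℂ H).symm ψ, (InnerProductSpace.toDual ℂ H).symm φ⟫_ℂ
  norm_sq_eq_re_inner φ := by
    rw [← (InnerProductSpace.toDual ℂ H).symm.norm_map φ]
    exact norm_sq_eq_re_inner (𝕜 := ℂ) _
  conj_inner_symm φ ψ := inner_conj_symm _ _
  add_left φ ψ χ := by simp
  smul_left φ ψ c := by
    rw [LinearIsometryEquiv.map_smulₛₗ, inner_smul_right]

theorem dual_inner_def (φ ψ : StrongDual ℂ H) :
    ⟪φ, ψ⟫_ℂ =
      ⟪(InnerProductSpace.toDual ℂ H).symm ψ, (InnerProductSpace.toDual ℂ H).symm φ⟫_ℂ :=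
  rfl

/-- The transpose `φ ↦ φ ∘ a` of a bounded operator `a`, as a bounded operator on the dual. -/
def transposeL (a : H →L[ℂ] H) : StrongDual ℂ H →L[ℂ] StrongDual ℂ H :=
  ContinuousLinearMap.precomp ℂ a

@[simp]
theorem transposeL_apply (a : H →L[ℂ] H) (φ : StrongDual ℂ H) (x : H) :
    transposeL a φ x = φ (a x) :=
  rfl

theorem transposeL_add (a b : H →L[ℂ] H) : transposeL (a + b) = transposeL a + transposeL b := by
  ext φ x
  simp

theorem transposeL_smul (c : ℂ) (a : H →L[ℂ] H) : transposeL (c • a) = c • transposeL a := by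
  ext φ x
  simp

theorem toDual_symm_transposeL (a : H →L[ℂ] H) (φ : StrongDual ℂ H) :
    (InnerProductSpace.toDual ℂ H).symm (transposeL a φ) =
      star a ((InnerProductSpace.toDual ℂ H).symm φ) := by
  refine ext_inner_right ℂ fun x => ?_
  rw [InnerProductSpace.toDual_symm_apply, ContinuousLinearMap.star_eq_adjoint,
    ContinuousLinearMap.adjoint_inner_left, InnerProductSpace.toDual_symm_apply, transposeL_apply]

theorem transposeL_star (a : H →L[ℂ] H) : transposeL (star a) = star (transposeL a) := by
  rw [ContinuousLinearMap.star_eq_adjoint (transposeL a), ContinuousLinearMap.eq_adjoint_iff]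
  intro φ ψ
  rw [dual_inner_def, dual_inner_def, toDual_symm_transposeL, toDual_symm_transposeL, star_star,
    ContinuousLinearMap.star_eq_adjoint, ContinuousLinearMap.adjoint_inner_left]

theorem transposeL_injective :
    Function.Injective (transposeL : (H →L[ℂ] H) → StrongDual ℂ H →L[ℂ] StrongDual ℂ H) := by
  intro a b h
  ext x
  refine ext_inner_left ℂ fun y => ?_
  have := congrArg (fun T => T (InnerProductSpace.toDual ℂ H y) x) h
  simpa using this

theorem transposeL_surjective :
    Function.Surjective (transposeL : (H →L[ℂ] H) → StrongDual ℂ H →L[ℂ] StrongDual ℂ H) := by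
  intro T
  let J := InnerProductSpace.toDual ℂ H
  let b : H →L[ℂ] H :=
    (J.symm.toContinuousLinearEquiv.toContinuousLinearMap.comp T).comp
      J.toContinuousLinearEquiv.toContinuousLinearMap
  refine ⟨star b, ?_⟩
  ext1 φ
  apply J.symm.injective
  rw [toDual_symm_transposeL, star_star]
  simp [b, J]

end DualHilbert

/-! ### Tensor products and opposites of von Neumann algebras -/

namespace VonNeumannAlgebra

section Tensor

variable {H : Type u} [NormedAddCommGroup H] [InnerProductSpace ℂ H] [CompleteSpace H]
variable {K : Type v} [NormedAddCommGroup K] [InnerProductSpace ℂ K] [CompleteSpace K]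

/-- The von Neumann algebra generated by a set `s` of bounded operators: the double commutant of
`s ∪ s*`. -/
def generatedBy (s : Set (H →L[ℂ] H)) : VonNeumannAlgebra H where
  toStarSubalgebra := StarSubalgebra.centralizer ℂ (StarSubalgebra.centralizer ℂ s : Set (H →L[ℂ] H))
  centralizer_centralizer' := by
    change Set.centralizer (Set.centralizer
      (StarSubalgebra.centralizer ℂ (StarSubalgebra.centralizer ℂ s : Set (H →L[ℂ] H)) : Set (H →L[ℂ] H))) =
      (StarSubalgebra.centralizer ℂ (StarSubalgebra.centralizer ℂ s : Set (H →L[ℂ] H)) : Set (H →L[ℂ] H))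
    rw [StarSubalgebra.coe_centralizer_centralizer, Set.centralizer_centralizer_centralizer]

theorem subset_generatedBy (s : Set (H →L[ℂ] H)) {x : H →L[ℂ] H} (hx : x ∈ s) :
    x ∈ (generatedBy s).toStarSubalgebra := by
  change x ∈ (StarSubalgebra.centralizer ℂ (StarSubalgebra.centralizer ℂ s : Set (H →L[ℂ] H)) : Set (H →L[ℂ] H))
  rw [StarSubalgebra.coe_centralizer_centralizer]
  exact Set.subset_centralizer_centralizer (Or.inl hx)

variable (H K) in
/-- The Hilbert space tensor product: the completion of the algebraic tensor product. -/
abbrev HilbertTensor : Type (max u v) := UniformSpace.Completion (H ⊗[ℂ] K)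

/-- The bounded operator `a ⊗ b` on the Hilbert space tensor product, determined by
`(a ⊗ b) (x ⊗ y) = a x ⊗ b y`. -/
def tensorOp (a : H →L[ℂ] H) (b : K →L[ℂ] K) : HilbertTensor H K →L[ℂ] HilbertTensor H K :=
  (TensorProduct.mapL a b).completion

theorem tensorOp_tmul (a : H →L[ℂ] H) (b : K →L[ℂ] K) (x : H) (y : K) :
    tensorOp a b ((x ⊗ₜ[ℂ] y : H ⊗[ℂ] K) : HilbertTensor H K) =
      ((a x ⊗ₜ[ℂ] b y : H ⊗[ℂ] K) : HilbertTensor H K) := by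
  simp [tensorOp]

/-- The von Neumann algebra tensor product `M ⊗̄ N`: the von Neumann algebra on the Hilbert space
tensor product generated by the operators `a ⊗ b` with `a ∈ M` and `b ∈ N`. -/
def tensor (M : VonNeumannAlgebra H) (N : VonNeumannAlgebra K) :
    VonNeumannAlgebra (HilbertTensor H K) :=
  generatedBy {x | ∃ a ∈ M, ∃ b ∈ N, x = tensorOp a b}

/-- The elementary tensor `a ⊗ b` as an element of `M ⊗̄ N`. -/
def elemTensor {M : VonNeumannAlgebra H} {N : VonNeumannAlgebra K}
    (a : M.toStarSubalgebra) (b : N.toStarSubalgebra) : (M.tensor N).toStarSubalgebra :=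
  ⟨tensorOp a.1 b.1, subset_generatedBy _ ⟨a.1, a.2, b.1, b.2, rfl⟩⟩

end Tensor

section Opposite

variable {H : Type u} [NormedAddCommGroup H] [InnerProductSpace ℂ H] [CompleteSpace H]

/-- The opposite von Neumann algebra of `M ⊆ B(H)`, in its canonical faithful normal representation
on the dual (equivalently, conjugate) Hilbert space, where `a ∈ M` acts as its transpose.
See `oppositeEquiv` for the isomorphism with the opposite algebra `Mᵐᵒᵖ`. -/
def opposite (M : VonNeumannAlgebra H) : VonNeumannAlgebra (StrongDual ℂ H) where
  carrier := transposeL '' (M : Set (H →L[ℂ] H))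
  mul_mem' := by
    rintro _ _ ⟨a, ha, rfl⟩ ⟨b, hb, rfl⟩
    exact ⟨b * a, mul_mem hb ha, rfl⟩
  one_mem' := ⟨1, one_mem M, rfl⟩
  add_mem' := by
    rintro _ _ ⟨a, ha, rfl⟩ ⟨b, hb, rfl⟩
    exact ⟨a + b, add_mem ha hb, by ext φ x; simp⟩
  zero_mem' := ⟨0, zero_mem M, by ext φ x; simp⟩
  algebraMap_mem' c := ⟨algebraMap ℂ _ c, M.algebraMap_mem' c, by
    ext φ x; simp [Algebra.algebraMap_eq_smul_one]⟩
  star_mem' := by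
    rintro _ ⟨a, ha, rfl⟩
    exact ⟨star a, star_mem ha, transposeL_star a⟩
  centralizer_centralizer' := by
    have key (s : Set (H →L[ℂ] H)) :
        Set.centralizer (transposeL '' s) = transposeL '' Set.centralizer s := by
      ext T
      obtain ⟨t, rfl⟩ := transposeL_surjective T
      rw [transposeL_injective.mem_set_image]
      simp only [Set.mem_centralizer_iff, Set.forall_mem_image]
      refine forall₂_congr fun a _ => ?_
      exact ⟨fun h => (transposeL_injective (a₁ := t * a) (a₂ := a * t) h).symm,
        fun h => congrArg transposeL h.symm⟩
    change Set.centralizer (Set.centralizer (transposeL '' (M : Set (H →L[ℂ] H)))) =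
      transposeL '' (M : Set (H →L[ℂ] H))
    rw [key, key, M.centralizer_centralizer]

/-- The opposite von Neumann algebra is the set `M` with the same linear structure and involution
and with the reversed multiplication. -/
def oppositeEquiv (M : VonNeumannAlgebra H) :
    (M.toStarSubalgebra)ᵐᵒᵖ ≃⋆ₐ[ℂ] M.opposite.toStarSubalgebra where
  toEquiv := Equiv.ofBijective
    (fun a => (⟨transposeL a.unop.1, a.unop.1, a.unop.2, rfl⟩ : M.opposite.toStarSubalgebra))
    ⟨fun _ _ h => MulOpposite.unop_injective <| Subtype.ext <|
      transposeL_injective <| congrArg Subtype.val h,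
    fun ⟨_, a, ha, h⟩ => ⟨.op ⟨a, ha⟩, Subtype.ext h⟩⟩
  map_mul' _ _ := rfl
  map_add' a b := Subtype.ext (transposeL_add a.unop.1 b.unop.1)
  map_smul' c a := Subtype.ext (transposeL_smul c a.unop.1)
  map_star' a := Subtype.ext (transposeL_star a.unop.1)

theorem coe_oppositeEquiv (M : VonNeumannAlgebra H) (a : (M.toStarSubalgebra)ᵐᵒᵖ) :
    (M.oppositeEquiv a : StrongDual ℂ H →L[ℂ] StrongDual ℂ H) = transposeL a.unop.1 :=
  rfl

end Opposite

/-! ### Traces and antiautomorphisms -/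

section Trace

variable {H : Type u} [NormedAddCommGroup H] [InnerProductSpace ℂ H] [CompleteSpace H]

/-- `τ` is a normal faithful tracial state on `M`. Normality: `τ` preserves the suprema of
increasing nets of self-adjoint elements. -/
structure IsNormalFaithfulTracialState (M : VonNeumannAlgebra H)
    (τ : M.toStarSubalgebra →ₗ[ℂ] ℂ) : Prop where
  nonneg : ∀ x, 0 ≤ τ (star x * x)
  map_one : τ 1 = 1
  faithful : ∀ x, τ (star x * x) = 0 → x = 0
  tracial : ∀ x y, τ (x * y) = τ (y * x)
  normal : ∀ (S : Set M.toStarSubalgebra) (s : M.toStarSubalgebra), S.Nonempty →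
    DirectedOn (· ≤ ·) S → (∀ x ∈ S, IsSelfAdjoint x) → IsLUB S s →
      IsLUB ((fun x => (τ x).re) '' S) (τ s).re

/-- `α` is an involutory `*`-antiautomorphism of `M`. -/
structure IsInvolutoryStarAntiautomorphism (M : VonNeumannAlgebra H)
    (α : M.toStarSubalgebra →ₗ[ℂ] M.toStarSubalgebra) : Prop where
  map_star : ∀ x, α (star x) = star (α x)
  map_mul : ∀ x y, α (x * y) = α y * α x
  involutory : ∀ x, α (α x) = x

end Trace

end VonNeumannAlgebra

end

/-! Let `J : H → H*` be the Riesz map. The flip `F (x ⊗ φ) = J⁻¹ φ ⊗ J x` extends to a conjugate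
linear isometric involution of `H ⊗ H*`, so `T ↦ F T* F` is an involutory `*`-antiautomorphism of
all bounded operators there; it is complex linear because the adjoint and the outer `F` each
conjugate the scalar. Conjugation by `J` turns the transpose of `b` into `b*`, and this star cancels
the one in `T*`: hence `a ⊗ bᵗ ↦ b ⊗ aᵗ` (`adjointConj_conjFlip_tensorOp`). The generators are thus
permuted, and an antiautomorphism preserving them preserves their bicommutant
(`map_mem_generatedBy`), so the map restricts to the tensor product. -/

noncomputable section

/-! ### Antiautomorphisms from conjugate linear involutions -/

section ConjugateTranspose

variable {E : Type*} [NormedAddCommGroup E] [InnerProductSpace ℂ E] [CompleteSpace E]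

/-- `T ↦ F ∘ T* ∘ F` for a bounded conjugate linear `F`, as a complex linear map. -/
def adjointConj (F : E →L⋆[ℂ] E) : (E →L[ℂ] E) →ₗ[ℂ] (E →L[ℂ] E) where
  toFun T := (F.comp (star T)).comp F
  map_add' S T := by ext x; simp
  map_smul' c T := by ext x; simp

@[simp]
theorem adjointConj_apply (F : E →L⋆[ℂ] E) (T : E →L[ℂ] E) (x : E) :
    adjointConj F T x = F (star T (F x)) :=
  rfl

variable {F : E →L⋆[ℂ] E} (hinv : ∀ x, F (F x) = x)

include hinv in
theorem adjointConj_mul (S T : E →L[ℂ] E) :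
    adjointConj F (S * T) = adjointConj F T * adjointConj F S := by
  ext x
  simp [hinv]

variable (hinner : ∀ x y, ⟪F x, F y⟫_ℂ = ⟪y, x⟫_ℂ)

include hinv hinner

-- Self-adjointness of `F` in the conjugate linear sense; it moves `F` across inner products below.
omit [CompleteSpace E] in
theorem inner_conj_left (x y : E) : ⟪F x, y⟫_ℂ = ⟪F y, x⟫_ℂ := by
  rw [← hinner, hinv]

theorem adjointConj_star (T : E →L[ℂ] E) :
    adjointConj F (star T) = star (adjointConj F T) := by
  rw [ContinuousLinearMap.star_eq_adjoint (adjointConj F T), ContinuousLinearMap.eq_adjoint_iff]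
  intro x y
  rw [adjointConj_apply, adjointConj_apply, star_star]
  calc ⟪F (T (F x)), y⟫_ℂ = ⟪F y, T (F x)⟫_ℂ := inner_conj_left hinv hinner _ _
    _ = ⟪star T (F y), F x⟫_ℂ := (ContinuousLinearMap.adjoint_inner_left T _ _).symm
    _ = ⟪x, F (star T (F y))⟫_ℂ := by
      conv_rhs => rw [← hinv x, hinner]

theorem adjointConj_adjointConj (T : E →L[ℂ] E) : adjointConj F (adjointConj F T) = T := by
  ext x
  rw [adjointConj_apply, ← adjointConj_star hinv hinner]
  simp [hinv]

end ConjugateTranspose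

/-! ### The conjugate linear flip -/

section Flip

variable {H K : Type*} [NormedAddCommGroup H] [InnerProductSpace ℂ H]
  [NormedAddCommGroup K] [InnerProductSpace ℂ K]

/-- The conjugate linear flip `x ⊗ J y ↦ y ⊗ J x` on the algebraic tensor product. -/
def conjFlipₗ (J : H ≃ₗᵢ⋆[ℂ] K) : H ⊗[ℂ] K →ₗ⋆[ℂ] H ⊗[ℂ] K :=
  (TensorProduct.map J.symm.toLinearEquiv.toLinearMap J.toLinearEquiv.toLinearMap).comp
    (TensorProduct.comm ℂ H K).toLinearMap

variable (J : H ≃ₗᵢ⋆[ℂ] K)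

@[simp]
theorem conjFlipₗ_tmul (x : H) (y : K) : conjFlipₗ J (x ⊗ₜ y) = J.symm y ⊗ₜ J x :=
  rfl

/-- Polarization reduces this to norms. Conjugate linearity changes the sign of `i`, and factoring
out a unit scalar then exchanges `x` and `y`. -/
theorem LinearIsometryEquiv.inner_map_map_conj (x y : H) : ⟪J x, J y⟫_ℂ = ⟪y, x⟫_ℂ := by
  rw [inner_eq_sum_norm_sq_div_four (𝕜 := ℂ), inner_eq_sum_norm_sq_div_four (𝕜 := ℂ)]
  have h₁ : ‖J x - Complex.I • J y‖ = ‖y - Complex.I • x‖ := by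
    rw [show J x - Complex.I • J y = J (x + Complex.I • y) by
        rw [map_add, map_smulₛₗ]; simp [sub_eq_add_neg], J.norm_map,
      show x + Complex.I • y = Complex.I • (y - Complex.I • x) by
        rw [smul_sub, smul_smul, Complex.I_mul_I]; module, norm_smul]
    simp
  have h₂ : ‖J x + Complex.I • J y‖ = ‖y + Complex.I • x‖ := by
    rw [show J x + Complex.I • J y = J (x - Complex.I • y) by
        rw [map_sub, map_smulₛₗ]; simp, J.norm_map,
      show x - Complex.I • y = -Complex.I • (y + Complex.I • x) by
        rw [smul_add, smul_smul, neg_mul, Complex.I_mul_I]; module, norm_smul]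
    simp
  simp only [RCLike.I_to_complex]
  rw [h₁, h₂, ← map_add, ← map_sub, J.norm_map, J.norm_map, add_comm x, norm_sub_rev x]

theorem inner_conjFlipₗ (s t : H ⊗[ℂ] K) : ⟪conjFlipₗ J s, conjFlipₗ J t⟫_ℂ = ⟪t, s⟫_ℂ := by
  induction s with
  | zero => simp
  | add s₁ s₂ h₁ h₂ => rw [map_add, inner_add_left, inner_add_right, h₁, h₂]
  | tmul x z =>
    induction t with
    | zero => simp
    | add t₁ t₂ h₁ h₂ => rw [map_add, inner_add_left, inner_add_right, h₁, h₂]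
    | tmul y w => simp [LinearIsometryEquiv.inner_map_map_conj, mul_comm]

/-- The conjugate linear flip `x ⊗ J y ↦ y ⊗ J x` on the Hilbert space tensor product. -/
def conjFlip : VonNeumannAlgebra.HilbertTensor H K →L⋆[ℂ] VonNeumannAlgebra.HilbertTensor H K :=
  ((conjFlipₗ J).mkContinuous 1 fun s => by
    -- The case `t = s` of `inner_conjFlipₗ` says that the flip preserves norms, whence the bound 1.
    rw [one_mul, @norm_eq_sqrt_re_inner ℂ, inner_conjFlipₗ]
    exact (@norm_eq_sqrt_re_inner ℂ _ _ _ _ s).ge).completion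

theorem conjFlip_coe (s : H ⊗[ℂ] K) :
    conjFlip J (s : VonNeumannAlgebra.HilbertTensor H K) = (conjFlipₗ J s : H ⊗[ℂ] K) := by
  simp [conjFlip]

theorem inner_conjFlip (s t : VonNeumannAlgebra.HilbertTensor H K) :
    ⟪conjFlip J s, conjFlip J t⟫_ℂ = ⟪t, s⟫_ℂ := by
  induction s, t using UniformSpace.Completion.induction_on₂ with
  | hp => exact isClosed_eq (by fun_prop) (by fun_prop)
  | ih s t =>
    rw [conjFlip_coe, conjFlip_coe, UniformSpace.Completion.inner_coe,
      UniformSpace.Completion.inner_coe, inner_conjFlipₗ]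

theorem conjFlip_conjFlip (s : VonNeumannAlgebra.HilbertTensor H K) :
    conjFlip J (conjFlip J s) = s := by
  induction s using UniformSpace.Completion.induction_on with
  | hp => exact isClosed_eq (by fun_prop) continuous_id
  | ih s =>
    rw [conjFlip_coe, conjFlip_coe]
    congr 1
    induction s with
    | zero => simp
    | add s₁ s₂ h₁ h₂ => rw [map_add, map_add, h₁, h₂]
    | tmul x y => simp

end Flip

/-! ### Action on elementary tensors -/

namespace VonNeumannAlgebra

theorem continuousLinearMap_ext_tmul {K L : Type*} [NormedAddCommGroup K]
    [InnerProductSpace ℂ K] [NormedAddCommGroup L] [InnerProductSpace ℂ L]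
    {S T : HilbertTensor K L →L[ℂ] HilbertTensor K L}
    (h : ∀ (x : K) (y : L), S ((x ⊗ₜ[ℂ] y : K ⊗[ℂ] L) : HilbertTensor K L) =
      T ((x ⊗ₜ[ℂ] y : K ⊗[ℂ] L) : HilbertTensor K L)) : S = T := by
  ext s
  induction s using UniformSpace.Completion.induction_on with
  | hp => exact isClosed_eq S.continuous T.continuous
  | ih s =>
    induction s with
    | zero => rw [UniformSpace.Completion.coe_zero, map_zero, map_zero]
    | add s₁ s₂ h₁ h₂ => rw [UniformSpace.Completion.coe_add, map_add, map_add, h₁, h₂]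
    | tmul x y => exact h x y

theorem star_tensorOp {K L : Type*} [NormedAddCommGroup K] [InnerProductSpace ℂ K]
    [CompleteSpace K] [NormedAddCommGroup L] [InnerProductSpace ℂ L] [CompleteSpace L]
    (a : K →L[ℂ] K) (b : L →L[ℂ] L) : star (tensorOp a b) = tensorOp (star a) (star b) := by
  symm
  rw [ContinuousLinearMap.star_eq_adjoint (tensorOp a b), ContinuousLinearMap.eq_adjoint_iff]
  intro s t
  induction s, t using UniformSpace.Completion.induction_on₂ with
  | hp => exact isClosed_eq (by fun_prop) (by fun_prop)
  | ih s t =>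
    induction s with
    | zero => rw [UniformSpace.Completion.coe_zero, map_zero, inner_zero_left, inner_zero_left]
    | add s₁ s₂ h₁ h₂ =>
      rw [UniformSpace.Completion.coe_add, map_add, inner_add_left, inner_add_left, h₁, h₂]
    | tmul x y =>
      induction t with
      | zero => rw [UniformSpace.Completion.coe_zero, map_zero, inner_zero_right, inner_zero_right]
      | add t₁ t₂ h₁ h₂ =>
        rw [UniformSpace.Completion.coe_add, map_add, inner_add_right, inner_add_right, h₁, h₂]
      | tmul z w =>
        simp [tensorOp_tmul, ContinuousLinearMap.star_eq_adjoint,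
          ContinuousLinearMap.adjoint_inner_left]

theorem adjointConj_conjFlip_tensorOp {H : Type*} [NormedAddCommGroup H]
    [InnerProductSpace ℂ H] [CompleteSpace H] (a b : H →L[ℂ] H) :
    adjointConj (conjFlip (InnerProductSpace.toDual ℂ H)) (tensorOp a (transposeL b)) = tensorOp b (transposeL a) := by
  refine continuousLinearMap_ext_tmul fun x φ => ?_
  -- The first use of `toDual_symm_transposeL` gives `J⁻¹ (b*)ᵗ J = b`; the reversed one gives `J a*
  -- J⁻¹ = aᵗ`.
  rw [adjointConj_apply, star_tensorOp, conjFlip_coe, conjFlipₗ_tmul, tensorOp_tmul, conjFlip_coe,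
    conjFlipₗ_tmul, tensorOp_tmul, ← transposeL_star, toDual_symm_transposeL, star_star,
    ← toDual_symm_transposeL]
  simp

end VonNeumannAlgebra

/-! ### Passage to the bicommutant -/

theorem Set.map_mem_centralizer_of_antimultiplicative {A : Type*} [Mul A] {β : A → A}
    (hmul : ∀ x y, β (x * y) = β y * β x) (hinv : ∀ x, β (β x) = x) {s : Set A}
    (hs : ∀ x ∈ s, β x ∈ s) {x : A} (hx : x ∈ s.centralizer) : β x ∈ s.centralizer := by
  intro y hy
  -- Since `y = β (β y)`, applying `β` to the commutation of `x` with `β y` gives that of `β x` with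
  -- `y`.
  have := congrArg β (hx (β y) (hs y hy))
  rwa [hmul, hmul, hinv, eq_comm] at this

namespace VonNeumannAlgebra

/-- The generated algebra is the bicommutant of `s ∪ s*`, so the centralizer lemma applies twice and
no continuity of `β` is needed. -/
theorem map_mem_generatedBy {E : Type*} [NormedAddCommGroup E] [InnerProductSpace ℂ E]
    [CompleteSpace E] {β : (E →L[ℂ] E) → (E →L[ℂ] E)}
    (hmul : ∀ x y, β (x * y) = β y * β x) (hstar : ∀ x, β (star x) = star (β x))
    (hinv : ∀ x, β (β x) = x) {s : Set (E →L[ℂ] E)} (hs : ∀ x ∈ s, β x ∈ s) {x : E →L[ℂ] E}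
    (hx : x ∈ (generatedBy s).toStarSubalgebra) : β x ∈ (generatedBy s).toStarSubalgebra := by
  change _ ∈ (StarSubalgebra.centralizer ℂ
    (StarSubalgebra.centralizer ℂ s : Set (E →L[ℂ] E)) : Set (E →L[ℂ] E)) at hx ⊢
  rw [StarSubalgebra.coe_centralizer_centralizer] at hx ⊢
  refine Set.map_mem_centralizer_of_antimultiplicative hmul hinv (fun y hy => ?_) hx
  refine Set.map_mem_centralizer_of_antimultiplicative hmul hinv (fun z hz => ?_) hy
  rcases hz with hz | hz
  · exact .inl (hs z hz)
  · exact .inr (Set.mem_star.2 (hstar z ▸ hs _ hz))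

end VonNeumannAlgebra

end

theorem mainTheorem5 {H : Type*} [NormedAddCommGroup H] [InnerProductSpace ℂ H] [CompleteSpace H]
    (M : VonNeumannAlgebra H) (τ : M.toStarSubalgebra →ₗ[ℂ] ℂ)
    (hτ : M.IsNormalFaithfulTracialState τ) :
    ∃ α : (M.tensor M.opposite).toStarSubalgebra →ₗ[ℂ] (M.tensor M.opposite).toStarSubalgebra,
      (M.tensor M.opposite).IsInvolutoryStarAntiautomorphism α ∧
      ∀ a b : M.toStarSubalgebra,
        α (VonNeumannAlgebra.elemTensor a (M.oppositeEquiv (MulOpposite.op b))) =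
          VonNeumannAlgebra.elemTensor b (M.oppositeEquiv (MulOpposite.op a)) := by
  let J := InnerProductSpace.toDual ℂ H
  have hmul := adjointConj_mul (conjFlip_conjFlip J)
  have hstar := adjointConj_star (conjFlip_conjFlip J) (inner_conjFlip J)
  have hinv := adjointConj_adjointConj (conjFlip_conjFlip J) (inner_conjFlip J)
  have hmem (x) (hx : x ∈ (M.tensor M.opposite).toStarSubalgebra) :
      adjointConj (conjFlip J) x ∈ (M.tensor M.opposite).toStarSubalgebra := by
    -- Only generators remain to be checked; `a` and `b` both range over `M`, so they may trade
    -- places.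
    refine VonNeumannAlgebra.map_mem_generatedBy hmul hstar hinv ?_ hx
    rintro _ ⟨a, ha, _, ⟨b, hb, rfl⟩, rfl⟩
    exact ⟨b, hb, transposeL a, ⟨a, ha, rfl⟩, VonNeumannAlgebra.adjointConj_conjFlip_tensorOp a b⟩
  refine ⟨
    { toFun := fun x => ⟨adjointConj (conjFlip J) x.1, hmem x.1 x.2⟩
      map_add' := fun x y => Subtype.ext (map_add (adjointConj (conjFlip J)) x.1 y.1)
      map_smul' := fun c x => Subtype.ext (map_smul (adjointConj (conjFlip J)) c x.1) },
    ⟨fun x => Subtype.ext (hstar x.1), fun x y => Subtype.ext (hmul x.1 y.1),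
      fun x => Subtype.ext (hinv x.1)⟩,
    fun a b => Subtype.ext (VonNeumannAlgebra.adjointConj_conjFlip_tensorOp a.1 b.1)⟩
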